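/- Let $n\ge 0$ and let $u:\mathbb C^{n+1}\to[-\infty,\infty]$ be a function whose restriction to the open unit ball $B_1\subset\mathbb C^{n+1}$ belongs to $\mathcal F^\infty(B_1)$. This means that on $B_1$ the function $u$ is plurisubharmonic (with values in $[-\infty,\infty)$) and satisfies $u(e^{i\theta}z)=u(z)$ for all $\theta\in\mathbb R$, and that it is finite and of class $C^2$ on $B_1\setminus\{0\}$. For $t<0$ let $u_t:\mathbb{CP}^n\to\mathbb R$ be the function $u_t([z])=u(e^t z/|z|)$ (well defined by the circular symmetry), and put $\dot u_t=\partial_t u_t$. Let $d^c=\frac i2(\bar\partial-\partial)$, so that $dd^c=i\partial\bar\partial$, and let $\omega_{FS}$ be the Fubini–Study form on $\mathbb{CP}^n$, given in each standard affine chart by $\omega_{FS}=\frac12 dd^c\log(1+\sum_\alpha|\zeta^\alpha|^2)$. Write $d_Bd^c_Bu$ for the form $dd^c u_t$ on $\mathbb{CP}^n$. Then for each $t<0$ the expression $$\Theta_2=\dot u_t\,\omega_{FS}+d_Bd^c_Bu$$ is a well-defined real $(1,1)$-form with continuous coefficients on $\mathbb{CP}^n$ (its expressions in the standard affine charts are continuous,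 of type $(1,1)$, and compatible under the coordinate changes), and it is positive, i.e. $\Theta_2\ge 0$: one has $\Theta_2(v,iv)\ge 0$ at every point and for every tangent vector $v$ of $\mathbb{CP}^n$. -/

import Mathlib

open scoped LinearAlgebra.Projectivization

noncomputable section

namespace CircularPsh

/-- The mean value `(1/2π) ∫_0^{2π} f(θ) dθ` of an extended-real-valued function, computed as the
mean of the positive part minus the mean of the negative part. For a function that is bounded above
the positive part has a finite mean, so the difference is a genuine element of `[-∞, ∞)`. -/
def circleMean (f : ℝ → EReal) : EReal :=
  (((ENNReal.ofReal (2 * Real.pi))⁻¹ *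
      ∫⁻ θ in Set.Ioc 0 (2 * Real.pi), (f θ).toENNReal : ENNReal) : EReal) -
    (((ENNReal.ofReal (2 * Real.pi))⁻¹ *
      ∫⁻ θ in Set.Ioc 0 (2 * Real.pi), (-f θ).toENNReal : ENNReal) : EReal)

/-- Plurisubharmonic functions with values in `[-∞, ∞)` on a domain `Ω` of a complex normed space:
upper semicontinuous, not identically `-∞`, and satisfying the sub-mean value inequality on every
closed complex disc `{a + s b : |s| ≤ 1}` contained in `Ω`. -/
structure IsPlurisubharmonicOn {E : Type*} [NormedAddCommGroup E] [NormedSpace ℂ E]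
    (u : E → EReal) (Ω : Set E) : Prop where
  lt_top : ∀ z ∈ Ω, u z < ⊤
  exists_ne_bot : ∃ z ∈ Ω, u z ≠ ⊥
  upperSemicontinuousOn : UpperSemicontinuousOn u Ω
  le_circleMean : ∀ a b : E, (∀ s : ℂ, ‖s‖ ≤ 1 → a + s • b ∈ Ω) →
    u a ≤ circleMean fun θ => u (a + Complex.exp (θ * Complex.I) • b)

/-- The family `F^∞(B_1)`: plurisubharmonic functions on the open unit ball of `ℂ^{n+1}` that are
invariant under `z ↦ e^{iθ} z` and (finite and) of class `C^2` on the punctured ball. -/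
structure FInfty (n : ℕ) (u : EuclideanSpace ℂ (Fin (n + 1)) → EReal) : Prop where
  psh : IsPlurisubharmonicOn u (Metric.ball 0 1)
  invariant : ∀ θ : ℝ, ∀ z ∈ Metric.ball (0 : EuclideanSpace ℂ (Fin (n + 1))) 1,
    u (Complex.exp (θ * Complex.I) • z) = u z
  ne_bot : ∀ z ∈ Metric.ball (0 : EuclideanSpace ℂ (Fin (n + 1))) 1 \ {0}, u z ≠ ⊥
  contDiffOn : ContDiffOn ℝ 2 (fun z => (u z).toReal)
    (Metric.ball (0 : EuclideanSpace ℂ (Fin (n + 1))) 1 \ {0})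

/-! ### Complex projective space and its affine charts -/

/-- Complex projective space `ℂℙ^n`. -/
abbrev CP (n : ℕ) : Type := ℙ ℂ (EuclideanSpace ℂ (Fin (n + 1)))

/-- The vector of `ℂ^{n+1}` with `j`-th entry `1` whose other entries are those of `ζ`, in order. -/
def homogenize {n : ℕ} (j : Fin (n + 1)) (ζ : EuclideanSpace ℂ (Fin n)) :
    EuclideanSpace ℂ (Fin (n + 1)) :=
  WithLp.toLp 2 (Fin.insertNth (α := fun _ => ℂ) j 1 (fun α => ζ α))

theorem homogenize_ne_zero {n : ℕ} (j : Fin (n + 1)) (ζ : EuclideanSpace ℂ (Fin n)) :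
    homogenize j ζ ≠ 0 := by
  intro h
  have h1 : homogenize j ζ j = 0 := by rw [h]; rfl
  simp [homogenize] at h1

/-- The affine parametrization of `U_j = {z^j ≠ 0} ⊆ ℂℙ^n` by `ℂ^n`. -/
def affine {n : ℕ} (j : Fin (n + 1)) (ζ : EuclideanSpace ℂ (Fin n)) : CP n :=
  Projectivization.mk ℂ (homogenize j ζ) (homogenize_ne_zero j ζ)

/-- The change of affine coordinates from `U_j` to `U_k`: the point `[z]` of `U_k` has the
coordinates `z^A / z^k`, `A ≠ k`. It is meaningful where `(homogenize j ζ) k ≠ 0`. -/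
def transition {n : ℕ} (j k : Fin (n + 1)) (ζ : EuclideanSpace ℂ (Fin n)) :
    EuclideanSpace ℂ (Fin n) :=
  WithLp.toLp 2 fun α => homogenize j ζ (k.succAbove α) / homogenize j ζ k

/-! ### Differential forms -/

/-- Multiplication by `i`, the standard complex structure of `ℂ^n`, as a real linear map. -/
def cplx (n : ℕ) : EuclideanSpace ℂ (Fin n) →L[ℝ] EuclideanSpace ℂ (Fin n) :=
  (Complex.I • ContinuousLinearMap.id ℂ (EuclideanSpace ℂ (Fin n))).restrictScalars ℝ

/-- The operator `d^c = (i/2)(∂̄ - ∂)` on real functions on `ℂ^n`. In real terms,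
`(d^c f)(v) = -(1/2) df(i v)`. -/
def dc {n : ℕ} (f : EuclideanSpace ℂ (Fin n) → ℝ) (ζ : EuclideanSpace ℂ (Fin n)) :
    EuclideanSpace ℂ (Fin n) [⋀^Fin 1]→L[ℝ] ℝ :=
  ContinuousAlternatingMap.ofSubsingleton ℝ (EuclideanSpace ℂ (Fin n)) ℝ 0
    ((-(1 / 2) : ℝ) • (fderiv ℝ f ζ).comp (cplx n))

/-- The real 2-form `d d^c f = i ∂∂̄ f` on `ℂ^n`. -/
def ddc {n : ℕ} (f : EuclideanSpace ℂ (Fin n) → ℝ) (ζ : EuclideanSpace ℂ (Fin n)) :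
    EuclideanSpace ℂ (Fin n) [⋀^Fin 2]→L[ℝ] ℝ :=
  extDeriv (dc f) ζ

/-- A real 2-form given by its expressions in the `n + 1` affine charts of `ℂℙ^n`. -/
abbrev ChartTwoForm (n : ℕ) : Type :=
  Fin (n + 1) → EuclideanSpace ℂ (Fin n) → EuclideanSpace ℂ (Fin n) [⋀^Fin 2]→L[ℝ] ℝ

/-- A family of 2-forms in the affine charts is a 2-form with continuous coefficients on `ℂℙ^n`:
the local expressions are continuous and are pulled back to each other by the coordinate changes. -/
structure ChartTwoForm.IsContinuousForm {n : ℕ} (Θ : ChartTwoForm n) : Prop where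
  continuous : ∀ j, Continuous (Θ j)
  compatible : ∀ (j k : Fin (n + 1)) (ζ : EuclideanSpace ℂ (Fin n)), homogenize j ζ k ≠ 0 →
    Θ j ζ = (Θ k (transition j k ζ)).compContinuousLinearMap (fderiv ℝ (transition j k) ζ)

/-- The real 2-form is of type `(1,1)`: `Θ(i v, i w) = Θ(v, w)`. -/
def ChartTwoForm.IsOneOne {n : ℕ} (Θ : ChartTwoForm n) : Prop :=
  ∀ (j : Fin (n + 1)) (ζ v w : EuclideanSpace ℂ (Fin n)),
    Θ j ζ ![Complex.I • v, Complex.I • w] = Θ j ζ ![v, w]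

/-- Semipositivity `Θ ≥ 0` of a real `(1,1)`-form: `Θ(v, i v) ≥ 0` for every tangent vector `v`. For
`Θ = i ∑ Θ_{αβ} dζ^α ∧ dζ̄^β` one has `Θ(v, i v) = 2 ∑ Θ_{αβ} v^α v̄^β`. -/
def ChartTwoForm.IsNonneg {n : ℕ} (Θ : ChartTwoForm n) : Prop :=
  ∀ (j : Fin (n + 1)) (ζ v : EuclideanSpace ℂ (Fin n)), 0 ≤ Θ j ζ ![v, Complex.I • v]

/-- The form `d d^c f` on `ℂℙ^n` of a function `f` on `ℂℙ^n`, in the affine charts. -/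
def ddcCP {n : ℕ} (f : CP n → ℝ) : ChartTwoForm n :=
  fun j => ddc fun ζ => f (affine j ζ)

/-- The Fubini-Study form `ω_FS = (1/2) d d^c log (1 + ∑ |ζ^α|^2)`, in the affine charts. -/
def omegaFS (n : ℕ) : ChartTwoForm n :=
  fun _ ζ => (1 / 2 : ℝ) • ddc (fun η => Real.log (1 + ∑ α, ‖η α‖ ^ 2)) ζ

/-! ### The form `Θ_2` -/

/-- `u_t`: the function on `ℂℙ^n` whose value at `[z]` is the value of `u` at the points of norm
`e^t` of the complex line spanned by `z`. For circular symmetric `u` and `t < 0` the choice of the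
point is immaterial. -/
def slice {n : ℕ} (u : EuclideanSpace ℂ (Fin (n + 1)) → EReal) (t : ℝ) (p : CP n) : ℝ :=
  (u ((Real.exp t / ‖p.rep‖) • p.rep)).toReal

/-- `u̇_t = ∂u_t/∂t`. -/
def sliceDot {n : ℕ} (u : EuclideanSpace ℂ (Fin (n + 1)) → EReal) (t : ℝ) (p : CP n) : ℝ :=
  deriv (fun s => slice u s p) t

/-- `Θ_2 = u̇_t ω_FS + d_B d^c_B u` on `ℂℙ^n`, where `d_B d^c_B u` is the form `d d^c u_t`. -/
def thetaTwo {n : ℕ} (u : EuclideanSpace ℂ (Fin (n + 1)) → EReal) (t : ℝ) : ChartTwoForm n :=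
  fun j ζ => sliceDot u t (affine j ζ) • omegaFS n j ζ + ddcCP (slice u t) j ζ

end CircularPsh

end

/-! In the chart `j`, write `h` for the homogenized vector, `ρ = log ‖h‖` for the Fubini–Study
potential and `F(ζ, s) = u(e^s h(ζ))`. Circular symmetry gives `u_t = F(ζ, t - ρ(ζ))` and `u̇_t =
∂_s F`. Differentiating twice along this graph produces the Hessian of `F` on the tangent vectors of
the graph, plus a term whose contribution to `d d^c u_t` is `-∂_s F · d d^c ρ`; adding `u̇_t ω_FS`
cancels exactly this term. Hence at a fixed `ζ` the form is `d d^c` of `F` along the graph of the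
affine function with the same 1-jet as `t - ρ` (`thetaTwo_eq_ddc`).

That affine function is the real part of a holomorphic one, so circular symmetry turns the
restriction into `u ∘ s` for a holomorphic section `s`. The form is then the pullback of `d d^c u`
by `s` (`ddc_comp`), and it is nonnegative because the sub-mean value inequality on small circles
makes the Levi form of `u` nonnegative (`FInfty.levi_nonneg`). Compatibility of the charts follows
from `ddc_comp` and the pluriharmonicity of `log |g|` for holomorphic `g` without zeros. -/

open scoped LinearAlgebra.Projectivization Topology

namespace CircularPsh

/-! ### Second derivatives of compositions. -/

section Calculus

variable {E F H : Type*} [NormedAddCommGroup E] [NormedSpace ℝ E] [NormedAddCommGroup F]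
  [NormedSpace ℝ F] [NormedAddCommGroup H] [NormedSpace ℝ H]

theorem ContDiffAt.eventually_differentiableAt {f : E → F} {x : E} (hf : ContDiffAt ℝ 2 f x) :
    ∀ᶠ y in 𝓝 x, DifferentiableAt ℝ f y :=
  (hf.eventually (by simp)).mono fun _ hy => hy.differentiableAt two_ne_zero

theorem ContDiffAt.differentiableAt_fderiv {f : E → F} {x : E} (hf : ContDiffAt ℝ 2 f x) :
    DifferentiableAt ℝ (fderiv ℝ f) x :=
  (hf.fderiv_right (m := 1) (by norm_num)).differentiableAt one_ne_zero

/-- The chain rule for second derivatives. -/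
theorem fderiv_fderiv_comp {f : F → H} {G : E → F} {x : E} (hf : ContDiffAt ℝ 2 f (G x))
    (hG : ContDiffAt ℝ 2 G x) (v w : E) :
    fderiv ℝ (fderiv ℝ (fun y => f (G y))) x v w =
      fderiv ℝ (fderiv ℝ f) (G x) (fderiv ℝ G x v) (fderiv ℝ G x w) +
        fderiv ℝ f (G x) (fderiv ℝ (fderiv ℝ G) x v w) := by
  have hev : fderiv ℝ (fun y => f (G y)) =ᶠ[𝓝 x]
      fun y => (fderiv ℝ f (G y)).comp (fderiv ℝ G y) := by
    filter_upwards [ContDiffAt.eventually_differentiableAt hG,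
      hG.continuousAt.eventually (ContDiffAt.eventually_differentiableAt hf)] with y h1 h2
    exact fderiv_comp y h2 h1
  rw [hev.fderiv_eq]
  have hGx : HasFDerivAt G (fderiv ℝ G x) x := (hG.differentiableAt two_ne_zero).hasFDerivAt
  have h1 : HasFDerivAt (fun y => fderiv ℝ f (G y)) _ x :=
    (ContDiffAt.differentiableAt_fderiv hf).hasFDerivAt.comp x hGx
  have h2 := (ContDiffAt.differentiableAt_fderiv hG).hasFDerivAt
  rw [(h1.clm_comp h2).fderiv]
  simp [add_comm]

end Calculus

/-! ### The operator `d d^c` on `ℂ^n` and its holomorphic invariance. -/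

section Ddc

variable {n m : ℕ}

theorem dc_apply (f : EuclideanSpace ℂ (Fin n) → ℝ) (ζ : EuclideanSpace ℂ (Fin n))
    (v : Fin 1 → EuclideanSpace ℂ (Fin n)) :
    dc f ζ v = -(1 / 2) * fderiv ℝ f ζ (Complex.I • v 0) := by
  simp [dc, cplx]

/-- The linear map that sends `df` to `d^c f`. -/
noncomputable def dcCLM (n : ℕ) : (EuclideanSpace ℂ (Fin n) →L[ℝ] ℝ) →L[ℝ]
    (EuclideanSpace ℂ (Fin n) [⋀^Fin 1]→L[ℝ] ℝ) :=
  (ContinuousAlternatingMap.ofSubsingletonLIE (𝕜 := ℝ) (E := EuclideanSpace ℂ (Fin n))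
      (F := ℝ) (0 : Fin 1)).toContinuousLinearEquiv.toContinuousLinearMap.comp
    ((-(1 / 2) : ℝ) • (ContinuousLinearMap.compL ℝ _ _ _).flip (cplx n))

theorem dc_eq_dcCLM (f : EuclideanSpace ℂ (Fin n) → ℝ) :
    dc f = fun ζ => dcCLM n (fderiv ℝ f ζ) := rfl

theorem contDiffAt_dc {f : EuclideanSpace ℂ (Fin n) → ℝ} {ζ : EuclideanSpace ℂ (Fin n)}
    (hf : ContDiffAt ℝ 2 f ζ) : ContDiffAt ℝ 1 (dc f) ζ := by
  rw [dc_eq_dcCLM]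
  exact (dcCLM n).contDiff.contDiffAt.comp ζ (hf.fderiv_right (m := 1) (by norm_num))

/-- Reduces computations with `d d^c` to the real Hessian: `d^c` is a fixed linear map applied to
`df`, and the exterior derivative antisymmetrizes its derivative. -/
theorem ddc_apply {f : EuclideanSpace ℂ (Fin n) → ℝ} {ζ : EuclideanSpace ℂ (Fin n)}
    (hf : ContDiffAt ℝ 2 f ζ) (v w : EuclideanSpace ℂ (Fin n)) :
    ddc f ζ ![v, w] = -(1 / 2) * (fderiv ℝ (fderiv ℝ f) ζ v (Complex.I • w) -
      fderiv ℝ (fderiv ℝ f) ζ w (Complex.I • v)) := by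
  have h : fderiv ℝ (dc f) ζ = (dcCLM n).comp (fderiv ℝ (fderiv ℝ f) ζ) := by
    rw [dc_eq_dcCLM]
    exact ((dcCLM n).hasFDerivAt.comp ζ
      (ContDiffAt.differentiableAt_fderiv hf).hasFDerivAt).fderiv
  rw [ddc, extDeriv, ContinuousAlternatingMap.alternatizeUncurryFin_apply, h]
  simp [dcCLM, cplx, Fin.sum_univ_two, Fin.removeNth]
  ring

theorem ddc_congr {f g : EuclideanSpace ℂ (Fin n) → ℝ} {ζ : EuclideanSpace ℂ (Fin n)}
    (h : f =ᶠ[𝓝 ζ] g) : ddc f ζ = ddc g ζ := by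
  have : dc f =ᶠ[𝓝 ζ] dc g := by
    rw [dc_eq_dcCLM, dc_eq_dcCLM]
    exact h.fderiv.fun_comp (dcCLM n)
  exact this.extDeriv_eq

theorem ddc_sub {f g : EuclideanSpace ℂ (Fin n) → ℝ} {ζ : EuclideanSpace ℂ (Fin n)}
    (hf : ContDiffAt ℝ 2 f ζ) (hg : ContDiffAt ℝ 2 g ζ) :
    ddc (fun η => f η - g η) ζ = ddc f ζ - ddc g ζ := by
  have h : fderiv ℝ (dc fun η => f η - g η) ζ = fderiv ℝ (dc f) ζ - fderiv ℝ (dc g) ζ := by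
    rw [← fderiv_sub ((contDiffAt_dc hf).differentiableAt one_ne_zero)
      ((contDiffAt_dc hg).differentiableAt one_ne_zero)]
    apply Filter.EventuallyEq.fderiv_eq
    filter_upwards [ContDiffAt.eventually_differentiableAt hf,
      ContDiffAt.eventually_differentiableAt hg] with y h1 h2
    simp [dc_eq_dcCLM, fderiv_fun_sub h1 h2]
  have := (ContinuousAlternatingMap.alternatizeUncurryFinCLM ℝ
    (EuclideanSpace ℂ (Fin n)) ℝ (n := 1)).map_sub (fderiv ℝ (dc f) ζ) (fderiv ℝ (dc g) ζ)
  rw [ddc, ddc, ddc, extDeriv, h]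
  exact this

theorem ddc_const_smul (c : ℝ) (f : EuclideanSpace ℂ (Fin n) → ℝ)
    (ζ : EuclideanSpace ℂ (Fin n)) : ddc (fun η => c * f η) ζ = c • ddc f ζ := by
  have : dc (fun η => c * f η) = c • dc f := by
    funext y
    have : fderiv ℝ (fun η => c * f η) y = c • fderiv ℝ f y :=
      congrFun (fderiv_const_smul_field (f := f) c) y
    simp only [dc_eq_dcCLM, this, map_smul, Pi.smul_apply]
  rw [ddc, this, extDeriv_smul, ddc]

theorem continuous_ddc {f : EuclideanSpace ℂ (Fin n) → ℝ} (hf : ContDiff ℝ 2 f) :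
    Continuous (ddc f) := by
  have h1 : ContDiff ℝ 1 (dc f) := contDiff_iff_contDiffAt.2 fun ζ => contDiffAt_dc hf.contDiffAt
  exact (ContinuousAlternatingMap.alternatizeUncurryFinCLM ℝ
    (EuclideanSpace ℂ (Fin n)) ℝ (n := 1)).continuous.comp (h1.continuous_fderiv one_ne_zero)

/-- `d d^c f` is of type `(1,1)`. -/
theorem ddc_I_smul {f : EuclideanSpace ℂ (Fin n) → ℝ} {ζ : EuclideanSpace ℂ (Fin n)}
    (hf : ContDiffAt ℝ 2 f ζ) (v w : EuclideanSpace ℂ (Fin n)) :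
    ddc f ζ ![Complex.I • v, Complex.I • w] = ddc f ζ ![v, w] := by
  have hs : IsSymmSndFDerivAt ℝ f ζ := hf.isSymmSndFDerivAt (by simp)
  -- After `i² = -1`, symmetry of the Hessian exchanges the two terms of the antisymmetrization.
  rw [ddc_apply hf, ddc_apply hf, smul_smul, smul_smul, Complex.I_mul_I, hs.eq (Complex.I • v),
    hs.eq (Complex.I • w)]
  simp
  ring

/-- Half the Laplacian along the complex line of `v`, which is the quantity controlled by means over
circles. -/
theorem ddc_self_I_smul {f : EuclideanSpace ℂ (Fin n) → ℝ} {ζ : EuclideanSpace ℂ (Fin n)}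
    (hf : ContDiffAt ℝ 2 f ζ) (v : EuclideanSpace ℂ (Fin n)) :
    ddc f ζ ![v, Complex.I • v] = 1 / 2 * (fderiv ℝ (fderiv ℝ f) ζ v v +
      fderiv ℝ (fderiv ℝ f) ζ (Complex.I • v) (Complex.I • v)) := by
  rw [ddc_apply hf, smul_smul, Complex.I_mul_I]
  simp
  ring

theorem fderiv_real_I_smul {E F : Type*} [NormedAddCommGroup E] [NormedSpace ℂ E]
    [NormedAddCommGroup F] [NormedSpace ℂ F] {G : E → F} {x : E} (hG : DifferentiableAt ℂ G x)
    (v : E) : fderiv ℝ G x (Complex.I • v) = Complex.I • fderiv ℝ G x v := by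
  rw [hG.fderiv_restrictScalars ℝ]
  simp

/-- `d d^c` commutes with the pullback by holomorphic maps. -/
theorem ddc_comp {f : EuclideanSpace ℂ (Fin m) → ℝ}
    {G : EuclideanSpace ℂ (Fin n) → EuclideanSpace ℂ (Fin m)} {ζ : EuclideanSpace ℂ (Fin n)}
    (hf : ContDiffAt ℝ 2 f (G ζ)) (hG : ContDiffAt ℂ 2 G ζ) :
    ddc (fun η => f (G η)) ζ = (ddc f (G ζ)).compContinuousLinearMap (fderiv ℝ G ζ) := by
  have hGr : ContDiffAt ℝ 2 G ζ := hG.restrict_scalars ℝ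
  have hev : dc (fun η => f (G η)) =ᶠ[𝓝 ζ]
      fun η => (dc f (G η)).compContinuousLinearMap (fderiv ℝ G η) := by
    filter_upwards [hG.eventually (by simp), hGr.continuousAt.eventually
      (ContDiffAt.eventually_differentiableAt hf)] with η h1 h2
    have h3 : DifferentiableAt ℂ G η := h1.differentiableAt two_ne_zero
    have h4 : fderiv ℝ (fun η => f (G η)) η = (fderiv ℝ f (G η)).comp (fderiv ℝ G η) :=
      fderiv_comp η h2 (h3.restrictScalars ℝ)
    ext v
    simp [dc_apply, h4, fderiv_real_I_smul h3]
  rw [ddc, hev.extDeriv_eq]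
  exact extDeriv_pullback ((contDiffAt_dc hf).differentiableAt one_ne_zero) hGr (by simp)

/-- The real part of a holomorphic function is pluriharmonic. -/
theorem ddc_re_eq_zero {g : EuclideanSpace ℂ (Fin n) → ℂ} {ζ : EuclideanSpace ℂ (Fin n)}
    (hg : ContDiffAt ℂ 2 g ζ) : ddc (fun η => (g η).re) ζ = 0 := by
  have hgr : ContDiffAt ℝ 2 g ζ := hg.restrict_scalars ℝ
  have him : ContDiffAt ℝ 2 (fun η => 1 / 2 * (g η).im) ζ :=
    contDiffAt_const.mul (Complex.imCLM.contDiff.contDiffAt.comp ζ hgr)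
  -- By the Cauchy–Riemann equations `d^c Re g = d(½ Im g)`, so the claim reduces to `d² = 0`; `ω`
  -- is `½ Im g` seen as a 0-form.
  set ω : EuclideanSpace ℂ (Fin n) → EuclideanSpace ℂ (Fin n) [⋀^Fin 0]→L[ℝ] ℝ :=
    fun η => ContinuousAlternatingMap.constOfIsEmpty ℝ _ (Fin 0) (1 / 2 * (g η).im) with hω
  have hωc : ContDiffAt ℝ 2 ω ζ :=
    (ContinuousAlternatingMap.constOfIsEmptyLIE ℝ (EuclideanSpace ℂ (Fin n)) ℝ
      (Fin 0)).toContinuousLinearEquiv.contDiff.contDiffAt.comp ζ him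
  have hev : dc (fun η => (g η).re) =ᶠ[𝓝 ζ] extDeriv ω := by
    filter_upwards [hg.eventually (by simp)] with η h1
    have h3 : DifferentiableAt ℂ g η := h1.differentiableAt two_ne_zero
    have h4 : HasFDerivAt g (fderiv ℝ g η) η := (h3.restrictScalars ℝ).hasFDerivAt
    have hre := (Complex.reCLM.hasFDerivAt.comp η h4).fderiv
    have him := ((Complex.imCLM.hasFDerivAt.comp η h4).const_mul (1 / 2 : ℝ)).fderiv
    simp only [Function.comp_def, Complex.reCLM_apply, Complex.imCLM_apply] at hre him
    rw [hω, extDeriv_constOfIsEmpty, him]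
    ext v
    simp [dc_apply, hre, fderiv_real_I_smul h3]
  rw [ddc, hev.extDeriv_eq]
  exact extDeriv_extDeriv_apply hωc (by simp)

/-- The logarithm of the modulus of a holomorphic function without zeros is pluriharmonic. -/
theorem ddc_log_norm_eq_zero {g : EuclideanSpace ℂ (Fin n) → ℂ} {ζ : EuclideanSpace ℂ (Fin n)}
    (hg : ContDiffAt ℂ 2 g ζ) (h0 : g ζ ≠ 0) : ddc (fun η => Real.log ‖g η‖) ζ = 0 := by
  -- Dividing by `g ζ` moves the value at `ζ` to `1`, away from the branch cut of the logarithm.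
  have hq : ContDiffAt ℂ 2 (fun η => Complex.log (g η / g ζ)) ζ := by
    refine (Complex.contDiffAt_log ?_).comp ζ (hg.div_const (g ζ))
    simp [div_self h0]
  have hqr : ContDiffAt ℝ 2 (fun η => (Complex.log (g η / g ζ)).re) ζ :=
    Complex.reCLM.contDiff.contDiffAt.comp ζ (hq.restrict_scalars ℝ)
  have hev : (fun η => Real.log ‖g η‖) =ᶠ[𝓝 ζ]
      fun η => (Complex.log (g η / g ζ) + Complex.log (g ζ)).re := by
    filter_upwards [hg.continuousAt.eventually_ne h0] with η hη
    rw [Complex.add_re, Complex.log_re, Complex.log_re, norm_div,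
      Real.log_div (by simpa) (by simpa)]
    ring
  rw [ddc_congr hev]
  exact ddc_re_eq_zero (hq.add contDiffAt_const)

end Ddc

/-! ### From the sub-mean value inequality to the Levi form. -/

/-- Taylor's formula of order two with the Peano form of the remainder. -/
theorem eventually_abs_taylor_two_le {E : Type*} [NormedAddCommGroup E] [NormedSpace ℝ E]
    {f : E → ℝ} {a : E} (hf : ContDiffAt ℝ 2 f a) {ε : ℝ} (hε : 0 < ε) :
    ∀ᶠ x in 𝓝 (0 : E), |f (a + x) - f a - fderiv ℝ f a x -
      1 / 2 * fderiv ℝ (fderiv ℝ f) a x x| ≤ ε * ‖x‖ ^ 2 := by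
  set B := fderiv ℝ (fderiv ℝ f) a with hB
  have hsymm : IsSymmSndFDerivAt ℝ f a := hf.isSymmSndFDerivAt (by simp)
  set φ : E → ℝ := fun x => f (a + x) - f a - fderiv ℝ f a x - 1 / 2 * B x x with hφ
  have htr : Filter.Tendsto (fun x : E => a + x) (𝓝 0) (𝓝 a) := by
    have h : Continuous fun x : E => a + x := by fun_prop
    simpa using h.tendsto 0
  -- Symmetry of `B` makes `B x` the derivative of `½ B x x`. The derivative of the remainder is
  -- then `o(‖x‖)`, and the mean value inequality on the ball of radius `‖x‖` gains one more power.
  have hder : ∀ᶠ x in 𝓝 (0 : E), HasFDerivAt φ (fderiv ℝ f (a + x) - fderiv ℝ f a - B x) x := by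
    filter_upwards [htr.eventually (ContDiffAt.eventually_differentiableAt hf)] with x hx
    have h1 : HasFDerivAt (fun x => f (a + x)) (fderiv ℝ f (a + x)) x := by
      exact hx.hasFDerivAt.comp x ((hasFDerivAt_id x).const_add a)
    have h2 := (B.hasFDerivAt (x := x)).clm_apply (hasFDerivAt_id x)
    refine (((h1.sub_const (f a)).sub (fderiv ℝ f a).hasFDerivAt).sub
      (h2.const_mul (1 / 2 : ℝ))).congr_fderiv ?_
    ext v
    have := hsymm.eq v x
    rw [← hB] at this
    simp [this]
    ring
  have hsmall : ∀ᶠ x in 𝓝 (0 : E), ‖fderiv ℝ f (a + x) - fderiv ℝ f a - B x‖ ≤ ε * ‖x‖ := by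
    have := (hasFDerivAt_iff_isLittleO_nhds_zero.1
      (ContDiffAt.differentiableAt_fderiv hf).hasFDerivAt).def hε
    exact this
  obtain ⟨δ, hδ, hball⟩ := Metric.eventually_nhds_iff_ball.1 (hder.and hsmall)
  filter_upwards [Metric.ball_mem_nhds (0 : E) hδ] with x hx
  have hsub : ∀ y ∈ Metric.closedBall (0 : E) ‖x‖, y ∈ Metric.ball (0 : E) δ := fun y hy =>
    Metric.closedBall_subset_ball (by simpa using hx) hy
  have := (convex_closedBall (0 : E) ‖x‖).norm_image_sub_le_of_norm_hasFDerivWithin_le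
    (f := φ) (C := ε * ‖x‖) (x := 0) (y := x)
    (fun y hy => (hball y (hsub y hy)).1.hasFDerivWithinAt)
    (fun y hy => (hball y (hsub y hy)).2.trans (by
      gcongr
      simpa using hy)) (by simp) (by simp)
  have h0 : φ 0 = 0 := by simp [hφ]
  rw [h0, sub_zero, sub_zero, Real.norm_eq_abs] at this
  calc |φ x| ≤ ε * ‖x‖ * ‖x‖ := this
    _ = ε * ‖x‖ ^ 2 := by ring

/-- The linear and mixed terms integrate to zero over a period, while `cos²` and `sin²` contribute
`π` each. -/
theorem integral_quadratic_cos_sin (c p q A C D : ℝ) :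
    ∫ θ in (0 : ℝ)..2 * Real.pi, (c + (p * Real.cos θ + q * Real.sin θ) +
      (A * Real.cos θ ^ 2 + C * (Real.sin θ * Real.cos θ) + D * Real.sin θ ^ 2)) =
      2 * Real.pi * c + Real.pi * (A + D) := by
  have hi : ∀ g : ℝ → ℝ, Continuous g →
      IntervalIntegrable g MeasureTheory.volume 0 (2 * Real.pi) :=
    fun g hg => hg.intervalIntegrable _ _
  rw [intervalIntegral.integral_add (hi _ (by fun_prop)) (hi _ (by fun_prop)),
    intervalIntegral.integral_add (hi _ (by fun_prop)) (hi _ (by fun_prop)),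
    intervalIntegral.integral_add (hi _ (by fun_prop)) (hi _ (by fun_prop)),
    intervalIntegral.integral_add (hi _ (by fun_prop)) (hi _ (by fun_prop)),
    intervalIntegral.integral_add (hi _ (by fun_prop)) (hi _ (by fun_prop))]
  simp only [intervalIntegral.integral_const_mul, integral_cos, integral_sin, integral_cos_sq,
    integral_sin_sq, integral_sin_mul_cos₁, intervalIntegral.integral_const]
  simp
  ring

/-- A `C^2` function with the sub-mean value property on small circles in the direction `b` has a
nonnegative Levi form in this direction. -/
theorem levi_nonneg_of_le_integral {E : Type*} [NormedAddCommGroup E] [NormedSpace ℂ E]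
    {f : E → ℝ} {a b : E} (hf : ContDiffAt ℝ 2 f a)
    (hmean : ∀ᶠ r : ℝ in 𝓝[>] (0 : ℝ), 2 * Real.pi * f a ≤
      ∫ θ in (0 : ℝ)..2 * Real.pi, f (a + Complex.exp ((θ : ℝ) * Complex.I) • ((r : ℂ) • b))) :
    0 ≤ fderiv ℝ (fderiv ℝ f) a b b +
      fderiv ℝ (fderiv ℝ f) a (Complex.I • b) (Complex.I • b) := by
  set B := fderiv ℝ (fderiv ℝ f) a with hB
  set J := Complex.I • b with hJ
  -- The Taylor error `ε r² ‖b‖²` integrates to `2π ε r² ‖b‖²`, and the Hessian terms to `(π r² /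
  -- 2)(B b b + B J J)`; the factor `4` is the ratio of `2π` to `π / 2`.
  suffices h : ∀ ε : ℝ, 0 < ε → -(4 * ‖b‖ ^ 2) * ε ≤ B b b + B J J by
    have hlim : Filter.Tendsto (fun ε : ℝ => -(4 * ‖b‖ ^ 2) * ε) (𝓝[>] 0) (𝓝 0) := by
      have : Continuous fun ε : ℝ => -(4 * ‖b‖ ^ 2) * ε := by fun_prop
      simpa using (this.tendsto 0).mono_left nhdsWithin_le_nhds
    exact le_of_tendsto hlim (Filter.eventually_of_mem self_mem_nhdsWithin fun ε hε => h ε hε)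
  intro ε hε
  have htr : Filter.Tendsto (fun x : E => a + x) (𝓝 0) (𝓝 a) := by
    have h : Continuous fun x : E => a + x := by fun_prop
    simpa using h.tendsto 0
  obtain ⟨δ, hδ, hball⟩ := Metric.eventually_nhds_iff_ball.1
    ((eventually_abs_taylor_two_le hf hε).and
      (htr.eventually (ContDiffAt.eventually_differentiableAt hf)))
  have hr : ∀ᶠ r in 𝓝[>] (0 : ℝ), r * ‖b‖ < δ := by
    have : Filter.Tendsto (fun r : ℝ => r * ‖b‖) (𝓝[>] 0) (𝓝 0) := by
      have h : Continuous fun r : ℝ => r * ‖b‖ := by fun_prop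
      simpa using (h.tendsto 0).mono_left nhdsWithin_le_nhds
    exact this.eventually (gt_mem_nhds hδ)
  obtain ⟨r, ⟨hr1, hr2⟩, hr0⟩ := ((hmean.and hr).and self_mem_nhdsWithin).exists
  have hr0 : 0 < r := hr0
  set x : ℝ → E := fun θ => Complex.exp (θ * Complex.I) • ((r : ℂ) • b) with hx
  have hxn : ∀ θ, ‖x θ‖ = r * ‖b‖ := fun θ => by
    simp [hx, norm_smul, Complex.norm_exp_ofReal_mul_I, abs_of_pos hr0]
  have hxe : ∀ θ, x θ = (r * Real.cos θ) • b + (r * Real.sin θ) • J := fun θ => by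
    simp only [hx, hJ, Complex.exp_mul_I, ← Complex.coe_smul, smul_smul, ← add_smul]
    congr 1
    push_cast
    ring
  have hxb : ∀ θ, x θ ∈ Metric.ball (0 : E) δ := fun θ => by simpa [hxn] using hr2
  have hxc : Continuous x := by
    rw [funext hxe]
    fun_prop
  have hfc : Continuous fun θ => f (a + x θ) := continuous_iff_continuousAt.2 fun θ =>
    (hball _ (hxb θ)).2.continuousAt.comp (f := fun θ => a + x θ)
      (continuous_const.add hxc).continuousAt
  have hle : ∀ θ, f (a + x θ) ≤ (f a + ε * (r * ‖b‖) ^ 2) +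
      (r * fderiv ℝ f a b * Real.cos θ + r * fderiv ℝ f a J * Real.sin θ) +
      (r ^ 2 / 2 * B b b * Real.cos θ ^ 2 +
        r ^ 2 / 2 * (B b J + B J b) * (Real.sin θ * Real.cos θ) +
        r ^ 2 / 2 * B J J * Real.sin θ ^ 2) := fun θ => by
    have h := (abs_le.1 (hball _ (hxb θ)).1).2
    rw [hxn] at h
    have h1 : fderiv ℝ f a (x θ) =
        r * fderiv ℝ f a b * Real.cos θ + r * fderiv ℝ f a J * Real.sin θ := by
      rw [hxe]
      simp only [map_add, map_smul, smul_eq_mul]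
      ring
    have h2 : 1 / 2 * B (x θ) (x θ) = r ^ 2 / 2 * B b b * Real.cos θ ^ 2 +
        r ^ 2 / 2 * (B b J + B J b) * (Real.sin θ * Real.cos θ) +
        r ^ 2 / 2 * B J J * Real.sin θ ^ 2 := by
      rw [hxe]
      simp only [map_add, map_smul, smul_eq_mul, add_apply, FunLike.coe_smul, Pi.smul_apply]
      ring
    linarith
  have hint := intervalIntegral.integral_mono_on (μ := MeasureTheory.volume)
    Real.two_pi_pos.le (hfc.intervalIntegrable _ _)
    ((by fun_prop : Continuous _).intervalIntegrable _ _) fun θ _ => hle θ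
  rw [integral_quadratic_cos_sin] at hint
  have h3 := hr1.trans hint
  have h4 : 0 ≤ Real.pi * r ^ 2 / 2 * (4 * ‖b‖ ^ 2 * ε + (B b b + B J J)) := by
    nlinarith
  have := nonneg_of_mul_nonneg_right h4 (by positivity)
  linarith

/-- The extended-real mean value of a continuous real function is its usual mean value. -/
theorem circleMean_coe {g : ℝ → ℝ} (hg : Continuous g) :
    circleMean (fun θ => (g θ : EReal)) =
      (((2 * Real.pi)⁻¹ * ∫ θ in (0 : ℝ)..2 * Real.pi, g θ : ℝ) : EReal) := by
  have hi : ∀ {h : ℝ → ℝ}, Continuous h → MeasureTheory.IntegrableOn h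
      (Set.Ioc 0 (2 * Real.pi)) := fun hh =>
    (hh.integrableOn_Icc (a := 0) (b := 2 * Real.pi)).mono_set Set.Ioc_subset_Icc_self
  have hfin : ∀ {h : ℝ → ℝ}, Continuous h →
      ∫⁻ θ in Set.Ioc 0 (2 * Real.pi), ENNReal.ofReal (h θ) ≠ ⊤ := fun hh =>
    (hi hh).lintegral_lt_top.ne
  have hc : ∀ P : ENNReal, P ≠ ⊤ → (((ENNReal.ofReal (2 * Real.pi))⁻¹ * P : ENNReal) : EReal) =
      (((2 * Real.pi)⁻¹ * P.toReal : ℝ) : EReal) := fun P hP => by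
    have hne : (ENNReal.ofReal (2 * Real.pi))⁻¹ * P ≠ ⊤ := by
      refine ENNReal.mul_ne_top ?_ hP
      simp [Real.pi_pos]
    rw [← EReal.coe_ennreal_toReal hne, ENNReal.toReal_mul, ENNReal.toReal_inv,
      ENNReal.toReal_ofReal Real.two_pi_pos.le]
  simp only [circleMean, ← EReal.coe_neg, EReal.real_coe_toENNReal]
  rw [hc _ (hfin hg), hc _ (hfin (h := fun θ => -g θ) hg.neg), ← EReal.coe_sub,
    intervalIntegral.integral_of_le Real.two_pi_pos.le,
    MeasureTheory.integral_eq_lintegral_pos_part_sub_lintegral_neg_part (hi hg), mul_sub]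

/-! ### Regularity and Levi form of functions in `F^∞`. -/

variable {n : ℕ} {u : EuclideanSpace ℂ (Fin (n + 1)) → EReal}

theorem FInfty.coe_toReal (hu : FInfty n u) {z : EuclideanSpace ℂ (Fin (n + 1))}
    (hz : z ∈ Metric.ball (0 : EuclideanSpace ℂ (Fin (n + 1))) 1 \ {0}) :
    ((u z).toReal : EReal) = u z :=
  EReal.coe_toReal (hu.psh.lt_top z hz.1).ne (hu.ne_bot z hz)

theorem isOpen_puncturedBall :
    IsOpen (Metric.ball (0 : EuclideanSpace ℂ (Fin (n + 1))) 1 \ {0}) :=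
  Metric.isOpen_ball.sdiff isClosed_singleton

theorem FInfty.contDiffAt (hu : FInfty n u) {z : EuclideanSpace ℂ (Fin (n + 1))}
    (hz : z ∈ Metric.ball (0 : EuclideanSpace ℂ (Fin (n + 1))) 1 \ {0}) :
    ContDiffAt ℝ 2 (fun z => (u z).toReal) z :=
  hu.contDiffOn.contDiffAt (isOpen_puncturedBall.mem_nhds hz)

/-- The Levi form of a function in `F^∞(B_1)` is nonnegative on the punctured ball. -/
theorem FInfty.levi_nonneg (hu : FInfty n u) {a : EuclideanSpace ℂ (Fin (n + 1))}
    (ha : a ∈ Metric.ball (0 : EuclideanSpace ℂ (Fin (n + 1))) 1 \ {0})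
    (b : EuclideanSpace ℂ (Fin (n + 1))) :
    0 ≤ fderiv ℝ (fderiv ℝ fun z => (u z).toReal) a b b +
      fderiv ℝ (fderiv ℝ fun z => (u z).toReal) a (Complex.I • b) (Complex.I • b) := by
  refine levi_nonneg_of_le_integral (hu.contDiffAt ha) ?_
  obtain ⟨δ, hδ, hball⟩ := Metric.isOpen_iff.1 isOpen_puncturedBall a ha
  have hr : ∀ᶠ r in 𝓝[>] (0 : ℝ), r * ‖b‖ < δ := by
    have : Filter.Tendsto (fun r : ℝ => r * ‖b‖) (𝓝[>] 0) (𝓝 0) := by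
      have h : Continuous fun r : ℝ => r * ‖b‖ := by fun_prop
      simpa using (h.tendsto 0).mono_left nhdsWithin_le_nhds
    exact this.eventually (gt_mem_nhds hδ)
  filter_upwards [hr, self_mem_nhdsWithin] with r hr hr0
  have hr0 : 0 < r := hr0
  -- Small discs around `a` also avoid the origin, so `u` is finite and continuous on their boundary
  -- circles and the extended-real mean is an ordinary integral.
  have hdisc : ∀ s : ℂ, ‖s‖ ≤ 1 → a + s • ((r : ℂ) • b) ∈
      Metric.ball (0 : EuclideanSpace ℂ (Fin (n + 1))) 1 \ {0} := fun s hs => by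
    apply hball
    rw [Metric.mem_ball, dist_self_add_left, norm_smul, norm_smul, Complex.norm_real,
      Real.norm_of_nonneg hr0.le]
    exact (mul_le_of_le_one_left (by positivity) hs).trans_lt hr
  have hcirc : ∀ θ : ℝ, a + Complex.exp (θ * Complex.I) • ((r : ℂ) • b) ∈
      Metric.ball (0 : EuclideanSpace ℂ (Fin (n + 1))) 1 \ {0} := fun θ =>
    hdisc _ (Complex.norm_exp_ofReal_mul_I θ).le
  have hc : Continuous fun θ : ℝ =>
      (u (a + Complex.exp (θ * Complex.I) • ((r : ℂ) • b))).toReal :=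
    hu.contDiffOn.continuousOn.comp_continuous (by fun_prop) hcirc
  have h := hu.psh.le_circleMean a ((r : ℂ) • b) fun s hs => (hdisc s hs).1
  have heq : (fun θ : ℝ => u (a + Complex.exp (θ * Complex.I) • ((r : ℂ) • b))) =
      fun θ : ℝ => ((u (a + Complex.exp (θ * Complex.I) • ((r : ℂ) • b))).toReal : EReal) :=
    funext fun θ => (hu.coe_toReal (hcirc θ)).symm
  rw [heq, circleMean_coe hc, ← hu.coe_toReal ha, EReal.coe_le_coe_iff] at h
  rwa [← div_eq_inv_mul, le_div_iff₀ Real.two_pi_pos, mul_comm] at h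

/-! ### Second derivatives along a graph. -/

section SecondDerivatives

variable {E : Type*} [NormedAddCommGroup E] [NormedSpace ℝ E]

theorem fderiv_fderiv_prodMk {F H : Type*} [NormedAddCommGroup F] [NormedSpace ℝ F]
    [NormedAddCommGroup H] [NormedSpace ℝ H] {f : E → F} {g : E → H} {x : E}
    (hf : ContDiffAt ℝ 2 f x) (hg : ContDiffAt ℝ 2 g x) (v w : E) :
    fderiv ℝ (fderiv ℝ fun y => (f y, g y)) x v w =
      (fderiv ℝ (fderiv ℝ f) x v w, fderiv ℝ (fderiv ℝ g) x v w) := by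
  have h1 : fderiv ℝ (Prod.fst : F × H → F) = fun _ => ContinuousLinearMap.fst ℝ F H :=
    funext fun _ => fderiv_fst
  have h2 : fderiv ℝ (Prod.snd : F × H → H) = fun _ => ContinuousLinearMap.snd ℝ F H :=
    funext fun _ => fderiv_snd
  -- The chain rule is read backwards: the projections have constant derivative, so only their
  -- first-order term survives.
  have e1 := fderiv_fderiv_comp (f := (Prod.fst : F × H → F)) contDiffAt_fst
    (hf.prodMk hg) v w
  have e2 := fderiv_fderiv_comp (f := (Prod.snd : F × H → H)) contDiffAt_snd
    (hf.prodMk hg) v w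
  rw [h1] at e1
  rw [h2] at e2
  refine Prod.ext ?_ ?_
  · simpa using e1.symm
  · simpa using e2.symm

/-- The second derivative of the restriction of a function to a graph. -/
theorem fderiv_fderiv_graph {F : E × ℝ → ℝ} {a : E → ℝ} {x : E}
    (hF : ContDiffAt ℝ 2 F (x, a x)) (ha : ContDiffAt ℝ 2 a x) (v w : E) :
    fderiv ℝ (fderiv ℝ fun y => F (y, a y)) x v w =
      fderiv ℝ (fderiv ℝ F) (x, a x) (v, fderiv ℝ a x v) (w, fderiv ℝ a x w) +
        fderiv ℝ (fderiv ℝ a) x v w * fderiv ℝ F (x, a x) (0, 1) := by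
  have hid : fderiv ℝ (fun y : E => y) = fun _ => ContinuousLinearMap.id ℝ E :=
    funext fun _ => fderiv_fun_id
  have hG : HasFDerivAt (fun y => (y, a y))
      ((ContinuousLinearMap.id ℝ E).prod (fderiv ℝ a x)) x :=
    (hasFDerivAt_id x).prodMk (ha.differentiableAt two_ne_zero).hasFDerivAt
  rw [fderiv_fderiv_comp (G := fun y => (y, a y)) hF (contDiffAt_id.prodMk ha),
    fderiv_fderiv_prodMk contDiffAt_fun_id ha, hG.fderiv, hid]
  congr 1
  -- The second derivative of `y ↦ (y, a y)` is vertical, a multiple of `(0, 1)`.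
  rw [← smul_eq_mul, ← map_smul]
  simp

end SecondDerivatives

/-! ### Affine charts and the Fubini–Study form. -/

section Homogenize

@[simp]
theorem homogenize_self (j : Fin (n + 1)) (ζ : EuclideanSpace ℂ (Fin n)) :
    homogenize j ζ j = 1 := by
  simp [homogenize]

@[simp]
theorem homogenize_succAbove (j : Fin (n + 1)) (ζ : EuclideanSpace ℂ (Fin n)) (α : Fin n) :
    homogenize j ζ (j.succAbove α) = ζ α := by
  simp [homogenize]

theorem contDiff_homogenize (j : Fin (n + 1)) : ContDiff ℂ 2 (homogenize (n := n) j) := by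
  rw [contDiff_euclidean]
  intro i
  refine Fin.succAboveCases j ?_ (fun α => ?_) i
  · simpa using contDiff_const
  · simp only [homogenize_succAbove]
    exact (EuclideanSpace.proj (𝕜 := ℂ) α).contDiff

theorem norm_homogenize_sq (j : Fin (n + 1)) (ζ : EuclideanSpace ℂ (Fin n)) :
    ‖homogenize j ζ‖ ^ 2 = 1 + ∑ α, ‖ζ α‖ ^ 2 := by
  rw [EuclideanSpace.norm_sq_eq, Fin.sum_univ_succAbove _ j]
  simp

theorem norm_homogenize_pos (j : Fin (n + 1)) (ζ : EuclideanSpace ℂ (Fin n)) :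
    0 < ‖homogenize j ζ‖ :=
  norm_pos_iff.2 (homogenize_ne_zero j ζ)

theorem homogenize_transition {j k : Fin (n + 1)} {ζ : EuclideanSpace ℂ (Fin n)}
    (h : homogenize j ζ k ≠ 0) :
    homogenize k (transition j k ζ) = (homogenize j ζ k)⁻¹ • homogenize j ζ := by
  ext i
  refine Fin.succAboveCases k ?_ (fun α => ?_) i
  · simp [h]
  · simp [transition, div_eq_inv_mul]

theorem affine_transition {j k : Fin (n + 1)} {ζ : EuclideanSpace ℂ (Fin n)}
    (h : homogenize j ζ k ≠ 0) : affine k (transition j k ζ) = affine j ζ :=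
  (Projectivization.mk_eq_mk_iff' ..).2 ⟨(homogenize j ζ k)⁻¹, (homogenize_transition h).symm⟩

theorem contDiff_homogenize_apply (j k : Fin (n + 1)) :
    ContDiff ℂ 2 fun ζ : EuclideanSpace ℂ (Fin n) => homogenize j ζ k :=
  contDiff_euclidean.1 (contDiff_homogenize j) k

theorem contDiffAt_transition {j k : Fin (n + 1)} {ζ : EuclideanSpace ℂ (Fin n)}
    (h : homogenize j ζ k ≠ 0) : ContDiffAt ℂ 2 (transition j k) ζ := by
  rw [contDiffAt_euclidean]
  intro α
  exact (contDiff_homogenize_apply j _).contDiffAt.div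
    (contDiff_homogenize_apply j k).contDiffAt h

/-- The Fubini-Study potential `(1/2) log (1 + ∑ |ζ^α|^2)`. -/
noncomputable def fubiniStudyPotential (ζ : EuclideanSpace ℂ (Fin n)) : ℝ :=
  1 / 2 * Real.log (1 + ∑ α, ‖ζ α‖ ^ 2)

theorem fubiniStudyPotential_eq (j : Fin (n + 1)) (ζ : EuclideanSpace ℂ (Fin n)) :
    fubiniStudyPotential ζ = Real.log ‖homogenize j ζ‖ := by
  rw [fubiniStudyPotential, ← norm_homogenize_sq j, Real.log_pow]
  push_cast
  ring

theorem exp_fubiniStudyPotential (j : Fin (n + 1)) (ζ : EuclideanSpace ℂ (Fin n)) :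
    Real.exp (fubiniStudyPotential ζ) = ‖homogenize j ζ‖ := by
  rw [fubiniStudyPotential_eq j, Real.exp_log (norm_homogenize_pos j ζ)]

theorem contDiff_fubiniStudyPotential :
    ContDiff ℝ 2 (fubiniStudyPotential : EuclideanSpace ℂ (Fin n) → ℝ) := by
  have h : ContDiff ℝ 2 fun ζ : EuclideanSpace ℂ (Fin n) => 1 + ∑ α, ‖ζ α‖ ^ 2 := by
    simp_rw [← EuclideanSpace.norm_sq_eq]
    exact contDiff_const.add (contDiff_norm_sq ℂ)
  exact contDiff_const.mul (h.log fun ζ => by positivity)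

theorem omegaFS_eq (j : Fin (n + 1)) (ζ : EuclideanSpace ℂ (Fin n)) :
    omegaFS n j ζ = ddc fubiniStudyPotential ζ :=
  (ddc_const_smul _ _ ζ).symm

/-- Changing charts rescales the homogeneous vector by the inverse of its `k`-th entry, so the
potential changes by the log-modulus of a holomorphic function without zeros near the point, which
is pluriharmonic. -/
theorem omegaFS_transition {j k : Fin (n + 1)} {ζ : EuclideanSpace ℂ (Fin n)}
    (h : homogenize j ζ k ≠ 0) :
    (omegaFS n k (transition j k ζ)).compContinuousLinearMap (fderiv ℝ (transition j k) ζ) =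
      omegaFS n j ζ := by
  rw [omegaFS_eq, omegaFS_eq, ← ddc_comp contDiff_fubiniStudyPotential.contDiffAt
    (contDiffAt_transition h)]
  have hg := (contDiff_homogenize_apply j k).contDiffAt (x := ζ)
  have hev : (fun η => fubiniStudyPotential (transition j k η)) =ᶠ[𝓝 ζ]
      fun η => fubiniStudyPotential η - Real.log ‖homogenize j η k‖ := by
    filter_upwards [hg.continuousAt.eventually_ne h] with η hη
    rw [fubiniStudyPotential_eq k, fubiniStudyPotential_eq j, homogenize_transition hη, norm_smul,
      Real.log_mul (by simpa) (norm_homogenize_pos j η).ne', norm_inv, Real.log_inv]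
    ring
  rw [ddc_congr hev, ddc_sub contDiff_fubiniStudyPotential.contDiffAt, ddc_log_norm_eq_zero hg h,
    sub_zero]
  exact ((hg.restrict_scalars ℝ).norm ℂ h).log (by simpa)

end Homogenize

/-! ### The lift of `u` to a chart, and regularity of `Θ_2`. -/

/-- The function `u(e^s h)` of the affine coordinates of `[h]` in the `j`-th chart and of `s`. -/
noncomputable def chartLift (u : EuclideanSpace ℂ (Fin (n + 1)) → EReal) (j : Fin (n + 1))
    (p : EuclideanSpace ℂ (Fin n) × ℝ) : ℝ :=
  (u (Real.exp p.2 • homogenize j p.1)).toReal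

/-- The vector has norm `e^(s + ρ)`, with `ρ` the Fubini–Study potential. -/
theorem exp_smul_homogenize_mem {j : Fin (n + 1)} {ζ : EuclideanSpace ℂ (Fin n)} {s : ℝ}
    (h : s + fubiniStudyPotential ζ < 0) : Real.exp s • homogenize j ζ ∈
      Metric.ball (0 : EuclideanSpace ℂ (Fin (n + 1))) 1 \ {0} := by
  refine ⟨?_, by simpa using homogenize_ne_zero j ζ⟩
  rw [mem_ball_zero_iff, norm_smul, ← exp_fubiniStudyPotential j, Real.norm_of_nonneg
    (Real.exp_pos s).le, ← Real.exp_add]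
  simpa using h

theorem FInfty.contDiffAt_chartLift (hu : FInfty n u) (j : Fin (n + 1))
    {p : EuclideanSpace ℂ (Fin n) × ℝ} (h : p.2 + fubiniStudyPotential p.1 < 0) :
    ContDiffAt ℝ 2 (chartLift u j) p := by
  refine (hu.contDiffAt (exp_smul_homogenize_mem h)).comp
    (f := fun p : EuclideanSpace ℂ (Fin n) × ℝ => Real.exp p.2 • homogenize j p.1) p ?_
  exact (Real.contDiff_exp.comp contDiff_snd).contDiffAt.smul
    (((contDiff_homogenize j).restrict_scalars ℝ).comp contDiff_fst).contDiffAt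

theorem FInfty.apply_smul (hu : FInfty n u) {c : ℂ} (hc : ‖c‖ = 1)
    {z : EuclideanSpace ℂ (Fin (n + 1))} (hz : z ∈ Metric.ball 0 1) : u (c • z) = u z := by
  have := hu.invariant c.arg z hz
  rwa [← one_mul (Complex.exp _), ← Complex.ofReal_one, ← hc, Complex.norm_mul_exp_arg_mul_I]
    at this

/-- The chosen representative of the line is `a • h` for some scalar `a ≠ 0`. Normalizing to norm
`e^t` leaves `e^(t - ρ) • h` up to the phase `a / |a|`, which circular symmetry removes. -/
theorem FInfty.slice_affine (hu : FInfty n u) {t : ℝ} (ht : t < 0) (j : Fin (n + 1))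
    (ζ : EuclideanSpace ℂ (Fin n)) :
    slice u t (affine j ζ) = chartLift u j (ζ, t - fubiniStudyPotential ζ) := by
  obtain ⟨a, ha⟩ := Projectivization.exists_smul_eq_mk_rep ℂ (homogenize j ζ)
    (homogenize_ne_zero j ζ)
  have ha0 : (a : ℂ) ≠ 0 := a.ne_zero
  have hrep : (affine j ζ).rep = (a : ℂ) • homogenize j ζ := ha.symm
  have hc : ‖(a : ℂ) / (‖(a : ℂ)‖ : ℂ)‖ = 1 := by
    rw [norm_div, Complex.norm_real, norm_norm, div_self (norm_ne_zero_iff.2 ha0)]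
  have hmem := (exp_smul_homogenize_mem (j := j) (ζ := ζ) (s := t - fubiniStudyPotential ζ)
    (by simpa using ht)).1
  rw [slice, chartLift, ← hu.apply_smul hc hmem, hrep, norm_smul, Real.exp_sub,
    exp_fubiniStudyPotential j]
  congr 2
  simp only [← Complex.coe_smul, smul_smul]
  congr 1
  push_cast
  field_simp

theorem FInfty.sliceDot_affine (hu : FInfty n u) {t : ℝ} (ht : t < 0) (j : Fin (n + 1))
    (ζ : EuclideanSpace ℂ (Fin n)) : sliceDot u t (affine j ζ) =
      fderiv ℝ (chartLift u j) (ζ, t - fubiniStudyPotential ζ) (0, 1) := by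
  have hev : (fun s => slice u s (affine j ζ)) =ᶠ[𝓝 t]
      fun s => chartLift u j (ζ, s - fubiniStudyPotential ζ) := by
    filter_upwards [gt_mem_nhds ht] with s hs using hu.slice_affine hs j ζ
  have hF := ((hu.contDiffAt_chartLift j (p := (ζ, t - fubiniStudyPotential ζ))
    (by simpa using ht)).differentiableAt two_ne_zero).hasFDerivAt
  have hp : HasDerivAt (fun s : ℝ => (ζ, s - fubiniStudyPotential ζ)) (0, 1) t :=
    (hasDerivAt_const t ζ).prodMk ((hasDerivAt_id t).sub_const _)
  rw [sliceDot, hev.deriv_eq]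
  exact (hF.comp_hasDerivAt t hp).deriv

theorem FInfty.contDiff_slice_affine (hu : FInfty n u) {t : ℝ} (ht : t < 0) (j : Fin (n + 1)) :
    ContDiff ℝ 2 fun ζ => slice u t (affine j ζ) := by
  rw [funext (hu.slice_affine ht j)]
  refine contDiff_iff_contDiffAt.2 fun ζ => ?_
  refine (hu.contDiffAt_chartLift j (by simpa using ht)).comp
    (f := fun ζ => (ζ, t - fubiniStudyPotential ζ)) ζ ?_
  exact contDiffAt_id.prodMk (contDiffAt_const.sub contDiff_fubiniStudyPotential.contDiffAt)

theorem FInfty.continuous_sliceDot_affine (hu : FInfty n u) {t : ℝ} (ht : t < 0)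
    (j : Fin (n + 1)) : Continuous fun ζ => sliceDot u t (affine j ζ) := by
  rw [funext (hu.sliceDot_affine ht j)]
  refine continuous_iff_continuousAt.2 fun ζ => ?_
  -- By `sliceDot_affine`, `u̇_t` is a first partial derivative of the `C^2` lift.
  have h : ContinuousAt (fderiv ℝ (chartLift u j)) (ζ, t - fubiniStudyPotential ζ) :=
    ((hu.contDiffAt_chartLift j (by simpa using ht)).fderiv_right (m := 1)
      (by norm_num)).continuousAt
  exact (h.comp (f := fun ζ => (ζ, t - fubiniStudyPotential ζ)) (continuous_id.prodMk
    (continuous_const.sub contDiff_fubiniStudyPotential.continuous)).continuousAt).clm_apply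
      continuousAt_const

theorem FInfty.thetaTwo_isContinuousForm (hu : FInfty n u) {t : ℝ} (ht : t < 0) :
    (thetaTwo u t).IsContinuousForm where
  continuous j := by
    have h : Continuous (omegaFS n j) := by
      rw [funext (omegaFS_eq j)]
      exact continuous_ddc contDiff_fubiniStudyPotential
    exact ((hu.continuous_sliceDot_affine ht j).smul h).add
      (continuous_ddc (hu.contDiff_slice_affine ht j))
  compatible j k ζ h := by
    have hev : (fun η => slice u t (affine j η)) =ᶠ[𝓝 ζ]
        fun η => slice u t (affine k (transition j k η)) := by
      filter_upwards [(contDiff_homogenize_apply j k).continuous.continuousAt.eventually_ne h]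
        with η hη
      rw [affine_transition hη]
    have hV : ddcCP (slice u t) j ζ = (ddcCP (slice u t) k
        (transition j k ζ)).compContinuousLinearMap (fderiv ℝ (transition j k) ζ) := by
      rw [ddcCP, ddcCP, ddc_congr hev]
      exact ddc_comp (f := fun η => slice u t (affine k η))
        (hu.contDiff_slice_affine ht k).contDiffAt (contDiffAt_transition h)
    rw [thetaTwo, thetaTwo, hV, ← omegaFS_transition h, affine_transition h]
    ext v
    simp

theorem FInfty.thetaTwo_isOneOne (hu : FInfty n u) {t : ℝ} (ht : t < 0) :
    (thetaTwo u t).IsOneOne := fun j ζ v w => by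
  have h1 := ddc_I_smul (contDiff_fubiniStudyPotential.contDiffAt (x := ζ)) v w
  have h2 := ddc_I_smul ((hu.contDiff_slice_affine ht j).contDiffAt (x := ζ)) v w
  simp only [thetaTwo, omegaFS_eq, ddcCP, ContinuousAlternatingMap.add_apply,
    ContinuousAlternatingMap.smul_apply, h1, h2]

/-! ### Positivity of `Θ_2`. -/

/-- At a point, `Θ_2` is the form `d d^c` of a section of `u` over the chart whose norm is constant
to first order. -/
theorem FInfty.thetaTwo_eq_ddc (hu : FInfty n u) {t : ℝ} (ht : t < 0) (j : Fin (n + 1))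
    (ζ v w : EuclideanSpace ℂ (Fin n)) : thetaTwo u t j ζ ![v, w] =
      ddc (fun η => chartLift u j (η, t - fubiniStudyPotential ζ -
        fderiv ℝ fubiniStudyPotential ζ (η - ζ))) ζ ![v, w] := by
  set ρ : EuclideanSpace ℂ (Fin n) → ℝ := fubiniStudyPotential with hρ
  set D := fderiv ℝ ρ ζ with hD
  have hρc : ContDiffAt ℝ 2 ρ ζ := contDiff_fubiniStudyPotential.contDiffAt
  have hFc : ContDiffAt ℝ 2 (chartLift u j) (ζ, t - ρ ζ) :=
    hu.contDiffAt_chartLift j (by simpa [hρ] using ht)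
  have hac : ContDiff ℝ 2 fun η => t - ρ ζ - D (η - ζ) := by fun_prop
  have ha0 : t - ρ ζ - D (ζ - ζ) = t - ρ ζ := by simp
  have hFc' : ContDiffAt ℝ 2 (chartLift u j) (ζ, t - ρ ζ - D (ζ - ζ)) := by rwa [ha0]
  -- The affine exponent agrees with `t - ρ` to first order at `ζ` but has zero second derivative.
  -- The two graph formulas therefore differ only by the `∂_s F · D²ρ` term, which `u̇_t ω_FS`
  -- compensates.
  have had : fderiv ℝ (fun η => t - ρ ζ - D (η - ζ)) = fun _ => -D := funext fun η => by
    have := (D.hasFDerivAt.comp η ((hasFDerivAt_id η).sub_const ζ)).const_sub (t - ρ ζ)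
    simpa [Function.comp_def] using this.fderiv
  have hbd : fderiv ℝ (fun η => t - ρ η) = fun η => -fderiv ℝ ρ η :=
    funext fun η => fderiv_const_sub _
  have hbdd : fderiv ℝ (fun η => -fderiv ℝ ρ η) ζ = -fderiv ℝ (fderiv ℝ ρ) ζ := fderiv_fun_neg
  have hV : (fun η => slice u t (affine j η)) = fun η => chartLift u j (η, t - ρ η) :=
    funext (hu.slice_affine ht j)
  have hVc := (hu.contDiff_slice_affine ht j).contDiffAt (x := ζ)
  rw [hV] at hVc
  have hWc : ContDiffAt ℝ 2 (fun η => chartLift u j (η, t - ρ ζ - D (η - ζ))) ζ :=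
    hFc'.comp (f := fun η => (η, t - ρ ζ - D (η - ζ))) ζ (contDiffAt_id.prodMk hac.contDiffAt)
  simp only [thetaTwo, omegaFS_eq, ddcCP, ContinuousAlternatingMap.add_apply,
    ContinuousAlternatingMap.smul_apply, hV, hu.sliceDot_affine ht j, ← hρ, smul_eq_mul]
  rw [ddc_apply hρc, ddc_apply hVc, ddc_apply hWc]
  simp only [fderiv_fderiv_graph hFc (contDiffAt_const.sub hρc),
    fderiv_fderiv_graph hFc' hac.contDiffAt, had, hbd, hbdd, ha0]
  simp [← hD]
  ring

/-- The first-order section of `thetaTwo_eq_ddc` can be made holomorphic by changing its phase,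
which `u` does not see; the Levi form of `u` then applies to the image of `v`. -/
theorem FInfty.thetaTwo_isNonneg (hu : FInfty n u) {t : ℝ} (ht : t < 0) :
    (thetaTwo u t).IsNonneg := fun j ζ v => by
  set ρ : EuclideanSpace ℂ (Fin n) → ℝ := fubiniStudyPotential with hρ
  set D := fderiv ℝ ρ ζ with hD
  -- The complex-linear functional with real part `D`; replacing `D` by `ℓ` in the exponent makes
  -- the section holomorphic.
  set ℓ : EuclideanSpace ℂ (Fin n) →L[ℂ] ℂ := StrongDual.extendRCLike D with hℓ
  have hℓD : ∀ η, (ℓ η).re = D η := fun η => by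
    simp [hℓ, StrongDual.extendRCLike_apply]
  set s : EuclideanSpace ℂ (Fin n) → EuclideanSpace ℂ (Fin (n + 1)) := fun η =>
    Complex.exp ((t - ρ ζ : ℝ) - ℓ (η - ζ)) • homogenize j η with hs
  have hsc : ContDiff ℂ 2 s := by
    refine ContDiff.smul (Complex.contDiff_exp.comp ?_) (contDiff_homogenize j)
    fun_prop
  have hev : (fun η => chartLift u j (η, t - ρ ζ - D (η - ζ))) =ᶠ[𝓝 ζ]
      fun η => (u (s η)).toReal := by
    have hc : Continuous fun η => t - ρ ζ - D (η - ζ) + ρ η := by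
      have := (contDiff_fubiniStudyPotential (n := n)).continuous
      fun_prop
    have h0 : t - ρ ζ - D (ζ - ζ) + ρ ζ < 0 := by simpa using ht
    -- Circular invariance is available only inside the unit ball, and negativity of this exponent
    -- keeps the section there. The phase relating the two sections is `e^(-i Im ℓ(η - ζ))`.
    filter_upwards [hc.continuousAt.eventually (gt_mem_nhds h0)] with η hη
    have hmem := (exp_smul_homogenize_mem (j := j) hη).1
    have hn : ‖Complex.exp (-(ℓ (η - ζ)).im * Complex.I)‖ = 1 := by
      simpa using Complex.norm_exp_ofReal_mul_I (-(ℓ (η - ζ)).im)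
    rw [chartLift, ← hu.apply_smul hn hmem]
    congr 2
    simp only [hs, ← Complex.coe_smul, smul_smul]
    rw [Complex.ofReal_exp, ← Complex.exp_add]
    congr 2
    conv_rhs => rw [← Complex.re_add_im (ℓ (η - ζ)), hℓD]
    push_cast
    ring
  have hsζ : s ζ ∈ Metric.ball (0 : EuclideanSpace ℂ (Fin (n + 1))) 1 \ {0} := by
    have : s ζ = Real.exp (t - ρ ζ) • homogenize j ζ := by
      simp [hs, ← Complex.coe_smul]
    rw [this]
    exact exp_smul_homogenize_mem (by simpa [hρ] using ht)
  rw [hu.thetaTwo_eq_ddc ht, ddc_congr hev,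
    ddc_comp (f := fun z => (u z).toReal) (hu.contDiffAt hsζ) hsc.contDiffAt]
  have hI := fderiv_real_I_smul (hsc.contDiffAt.differentiableAt (x := ζ) two_ne_zero) v
  have hvec : (fderiv ℝ s ζ) ∘ ![v, Complex.I • v] =
      ![fderiv ℝ s ζ v, Complex.I • fderiv ℝ s ζ v] := by
    ext i : 1
    fin_cases i
    · rfl
    · exact hI
  rw [ContinuousAlternatingMap.compContinuousLinearMap_apply, hvec,
    ddc_self_I_smul (hu.contDiffAt hsζ)]
  exact mul_nonneg (by norm_num) (hu.levi_nonneg hsζ _)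

end CircularPsh

theorem lemma4p4 (n : ℕ) (u : EuclideanSpace ℂ (Fin (n + 1)) → EReal)
    (hu : CircularPsh.FInfty n u) (t : ℝ) (ht : t < 0) :
    (CircularPsh.thetaTwo u t).IsContinuousForm ∧
      (CircularPsh.thetaTwo u t).IsOneOne ∧
      (CircularPsh.thetaTwo u t).IsNonneg :=
  ⟨hu.thetaTwo_isContinuousForm ht, hu.thetaTwo_isOneOne ht, hu.thetaTwo_isNonneg ht⟩
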